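/- Let $\mathscr C$ be a Grothendieck category with a family $\{G_i\}_{i\in\Lambda}$ of finitely generated projective generators, and let $(T,\theta,\zeta)$ be a monad on $\mathscr C$ such that $T$ is exact and preserves colimits. Let $EM_T$ be its Eilenberg–Moore category of $T$-modules $(M,f_M)$, and regard $TG_i$ as the $T$-module $(TG_i,\theta_{G_i})$. Let $n\ge 0$ and let $\Delta=\{\Delta_i:T\to T\}_{i=0}^n$ be a higher derivation of order $n$ on $T$, i.e. natural transformations with $\Delta_0=1_T$ and $\Delta_i\circ\theta=\theta\circ\sum_{k=0}^{i}\Delta_k\ast\Delta_{i-k}$ for all $0\le i\le n$. A higher $\Delta$-derivation of order $n$ on $(M,f_M)\in EM_T$ is a family $D=\{D_i:M\to M\}_{i=0}^n$ of morphisms of $\mathscr C$ with $D_0=1_M$ and $D_i\circ f_M=f_M\circ\sum_{k=0}^{i}T(D_{i-k})\circ(\Delta_k)_M$ for all $0\le i\le n$. Let $\tau=(\mathscr T,\mathscr F)$ be a hereditary torsion theory on $EM_T$. For $i\in\Lambda$ let $\mathcal L_{TG_i}$ be the corresponding Gabriel filter, the set of subobjects $I\subseteq TG_i$ in $EM_T$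 with $TG_i/I\in\mathscr T$. For $M\in EM_T$ let $M_\tau\subseteq M$ be its torsion subobject, the sum of all subobjects $N\subseteq M$ in $EM_T$ such that $\ker(g)\in\mathcal L_{TG_i}$ for all $i\in\Lambda$ and all $g\in EM_T(TG_i,N)$. For a morphism $\varphi$ of $\mathscr C$ between underlying objects of $T$-modules, $\varphi(K)\subseteq L$ means that the restriction of $\varphi$ to $K$ factors through $L$. Then the following statements are equivalent. (i) The family $\{\mathcal L_{TG_i}\}_{i\in\Lambda}$ is $\Delta$-invariant of order $n$: for every $i\in\Lambda$ and $I\in\mathcal L_{TG_i}$ there is $J\in\mathcal L_{TG_i}$ with $(\Delta_j)_{G_i}(J)\subseteq I$ for all $j=0,1,\dots,n$. (ii) $\tau$ is higher differential of order $n$: for every $(M,f_M)\in EM_T$ and every higher $\Delta$-derivation $D$ of order $n$ on $M$, $D_j(M_\tau)\subseteq M_\tau$ for all $j=0,1,\dots,n$. (iii) For every $(M,f_M)\in EM_T$, every higher $\Delta$-derivation $D$ of order $n$ on $M$, every submodule $N\subseteq M_\tau$, every $j\in\{0,\dots,n\}$, every $i\in\Lambda$ and every morphism $g:TG_i\to N$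 in $EM_T$, there exists $K\in\mathcal L_{TG_i}$ such that $(\Delta_j)_{G_i}(K)\subseteq\ker(g)$. (iv) For every $(M,f_M)\in EM_T$, every higher $\Delta$-derivation $D$ of order $n$ on $M$, every submodule $N\subseteq M_\tau$, every $i\in\Lambda$ and every morphism $g:TG_i\to N$ in $EM_T$, there exists $K\in\mathcal L_{TG_i}$ such that $(\Delta_j)_{G_i}(K)\subseteq\ker(g)$ for all $j=0,1,\dots,n$. -/

import Mathlib

open CategoryTheory CategoryTheory.Limits

universe w v u

/-! ### Torsion theories and finitely generated objects in abelian categories -/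

section AbelianCategories

variable {A : Type u} [Category.{v} A] [Abelian A]

/-- A torsion theory on an abelian category: a pair of (strictly) full subcategories
`(torsion, torsionFree)` such that there are no nonzero morphisms from torsion objects to
torsion-free ones, and every object `M` sits in a short exact sequence `0 ⟶ M' ⟶ M ⟶ M'' ⟶ 0`
with `M'` torsion and `M''` torsion-free. -/
structure TorsionTheory (A : Type u) [Category.{v} A] [Abelian A] where
  /-- The torsion class. -/
  torsion : ObjectProperty A
  /-- The torsion-free class. -/
  torsionFree : ObjectProperty A
  torsion_of_iso : ∀ {X Y : A}, (X ≅ Y) → torsion X → torsion Y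
  torsionFree_of_iso : ∀ {X Y : A}, (X ≅ Y) → torsionFree X → torsionFree Y
  hom_eq_zero : ∀ {X Y : A}, torsion X → torsionFree Y → ∀ f : X ⟶ Y, f = 0
  exists_shortExact : ∀ M : A, ∃ (M' M'' : A) (f : M' ⟶ M) (g : M ⟶ M'') (h : f ≫ g = 0),
    torsion M' ∧ torsionFree M'' ∧ (ShortComplex.mk f g h).ShortExact

/-- A torsion theory is hereditary if its torsion class is closed under subobjects. -/
def TorsionTheory.IsHereditary (τ : TorsionTheory A) : Prop :=
  ∀ ⦃X Y : A⦄ (f : X ⟶ Y), Mono f → τ.torsion Y → τ.torsion X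

/-- The filter of subobjects `I` of `X` with `X / I` torsion. For `X` running through a family of
finitely generated projective generators, these are the Gabriel filters corresponding to `τ`. -/
noncomputable def TorsionTheory.gabrielFilter (τ : TorsionTheory A) (X : A) : Set (Subobject X) :=
  {I | τ.torsion (cokernel I.arrow)}

/-- An object `X` is finitely generated if whenever it is the supremum of a (nonempty) directed
family of subobjects, it is one of them. -/
def IsFinitelyGeneratedObject (X : A) : Prop :=
  ∀ S : Set (Subobject X), S.Nonempty → DirectedOn (· ≤ ·) S → IsLUB S ⊤ → ⊤ ∈ S

/-- `|M_τ|`: the subobjects `N` of `M` such that the kernel of every morphism `H i ⟶ N` from one of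
the given generators lies in the corresponding Gabriel filter. -/
noncomputable def TorsionTheory.torsionSubobjects (τ : TorsionTheory A) {Λ : Type w} (H : Λ → A)
    (M : A) : Set (Subobject M) :=
  {N | ∀ (i : Λ) (g : H i ⟶ (N : A)), kernelSubobject g ∈ τ.gabrielFilter (H i)}

/-- The torsion subobject `M_τ`: the sum of all members of `|M_τ|`. -/
noncomputable def TorsionTheory.torsionSubobject [IsGrothendieckAbelian.{w} A]
    (τ : TorsionTheory A) {Λ : Type w} (H : Λ → A) (M : A) : Subobject M :=
  sSup (τ.torsionSubobjects H M)

end AbelianCategories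

/-! ### The Eilenberg–Moore category of an exact colimit-preserving monad is Grothendieck -/

section EilenbergMoore

theorem isSeparator_free_algebra {C : Type u} [Category.{v} C] (T : Monad C) {S : C} (hS : IsSeparator S) : IsSeparator (T.free.obj S) := by
  rw [isSeparator_def]
  intro X Y f g h
  apply T.forget.map_injective
  refine (isSeparator_def S).1 hS _ _ fun k => ?_
  have := congrArg (T.adj.homEquiv _ _) (h ((T.adj.homEquiv _ _).symm k))
  simpa [Adjunction.homEquiv_naturality_right] using this

variable {C : Type u} [Category.{v} C] [Abelian C] (T : Monad C)

instance Monad.additiveOfExact [PreservesFiniteLimits T.toFunctor]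
    [PreservesFiniteColimits T.toFunctor] : T.toFunctor.Additive :=
  Functor.additive_of_preserves_binary_products _

noncomputable instance Monad.algebraAbelian [PreservesFiniteLimits T.toFunctor]
    [PreservesFiniteColimits T.toFunctor] : Abelian T.Algebra :=
  have : HasFiniteLimits T.Algebra :=
    ⟨fun _ _ _ => hasLimitsOfShape_of_hasLimitsOfShape_createsLimitsOfShape T.forget⟩
  have : HasFiniteColimits T.Algebra :=
    ⟨fun _ _ _ => hasColimitsOfShape_of_hasColimitsOfShape_createsColimitsOfShape T.forget⟩
  have : HasFiniteProducts T.Algebra := inferInstance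
  have : ∀ {X Y : T.Algebra} (f : X ⟶ Y), IsIso (Abelian.coimageImageComparison f) := by
    intro X Y f
    have : IsIso (T.forget.map (Abelian.coimageImageComparison f)) := by
      rw [Arrow.isIso_iff_isIso_of_isIso
        (Abelian.PreservesCoimageImageComparison.iso T.forget f).hom]
      infer_instance
    exact isIso_of_reflects_iso _ T.forget
  Abelian.ofCoimageImageComparisonIsIso

instance Monad.algebra_isGrothendieckAbelian [IsGrothendieckAbelian.{w} C]
    [PreservesFiniteLimits T.toFunctor] [PreservesFiniteColimits T.toFunctor]
    [PreservesColimitsOfSize.{w, w} T.toFunctor] : IsGrothendieckAbelian.{w} T.Algebra :=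
  have h : HasFilteredColimitsOfSize.{w, w} T.Algebra :=
    ⟨fun _ _ _ => hasColimitsOfShape_of_hasColimitsOfShape_createsColimitsOfShape T.forget⟩
  { locallySmall := locallySmall_of_faithful T.forget
    hasFilteredColimitsOfSize := h
    ab5OfSize := ⟨fun J _ _ => HasExactColimitsOfShape.domain_of_functor J T.forget⟩
    hasSeparator := ⟨_, isSeparator_free_algebra T (isSeparator_separator C)⟩ }

/-! ### Higher derivations -/

/-- A higher derivation of order `n` on a monad `(T, θ, ζ)`: natural transformations
`Δ₀ = 1, Δ₁, …, Δₙ : T ⟶ T` with `Δᵢ ∘ θ = θ ∘ (∑_{k ≤ i} Δₖ ∗ Δᵢ₋ₖ)` for all `i`.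
(For `k ≤ i` the subtraction `i - k` in `Fin (n + 1)` is the usual one.) -/
structure HigherDerivation (n : ℕ) where
  /-- The components `Δᵢ`. -/
  Δ : Fin (n + 1) → (T.toFunctor ⟶ T.toFunctor)
  zero : Δ 0 = 𝟙 _
  comm : ∀ i, T.μ ≫ Δ i = (∑ k ∈ Finset.Iic i, (Δ (i - k) ◫ Δ k)) ≫ T.μ

variable {T}

/-- A higher `Δ`-derivation of order `n` on a `T`-module `(M, f_M)`: morphisms
`D₀ = 1, D₁, …, Dₙ : M ⟶ M` in the base category with
`Dᵢ ∘ f_M = f_M ∘ (∑_{k ≤ i} T Dᵢ₋ₖ ∘ (Δₖ)_M)` for all `i`. -/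
structure ModuleHigherDerivation {n : ℕ} (Δ : HigherDerivation T n) (M : T.Algebra) where
  /-- The components `Dᵢ`. -/
  D : Fin (n + 1) → (M.A ⟶ M.A)
  zero : D 0 = 𝟙 _
  comm : ∀ i, M.a ≫ D i = (∑ k ∈ Finset.Iic i, (Δ.Δ k).app M.A ≫ T.map (D (i - k))) ≫ M.a

/-- `φ(K) ⊆ L`, for a morphism `φ` of the base category between the underlying objects of
`T`-modules and `T`-submodules `K`, `L`: the restriction of `φ` to `K` factors through `L`. -/
def MapsSubmodule {M N : T.Algebra} (φ : M.A ⟶ N.A) (K : Subobject M) (L : Subobject N) : Prop :=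
  ∃ h : (K : T.Algebra).A ⟶ (L : T.Algebra).A, h ≫ L.arrow.f = K.arrow.f ≫ φ

variable [PreservesFiniteLimits T.toFunctor] [PreservesFiniteColimits T.toFunctor]

/-- The family of Gabriel filters `L_{T G_i}` corresponding to `τ` is `Δ`-invariant of order `n`. -/
def IsDeltaInvariant {n : ℕ} (Δ : HigherDerivation T n) (τ : TorsionTheory T.Algebra)
    {Λ : Type w} (G : Λ → C) : Prop :=
  ∀ (i : Λ), ∀ I ∈ τ.gabrielFilter (T.free.obj (G i)),
    ∃ J ∈ τ.gabrielFilter (T.free.obj (G i)),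
      ∀ j : Fin (n + 1), MapsSubmodule ((Δ.Δ j).app (G i)) J I

/-- The torsion theory `τ` is higher differential of order `n`: every higher `Δ`-derivation `D` of
order `n` on every `T`-module `M` satisfies `Dⱼ(M_τ) ⊆ M_τ` for all `j ≤ n`. -/
def IsHigherDifferential [IsGrothendieckAbelian.{w} C] [PreservesColimitsOfSize.{w, w} T.toFunctor]
    {n : ℕ} (Δ : HigherDerivation T n) (τ : TorsionTheory T.Algebra)
    {Λ : Type w} (G : Λ → C) : Prop :=
  ∀ (M : T.Algebra) (D : ModuleHigherDerivation Δ M) (j : Fin (n + 1)),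
    MapsSubmodule (D.D j) (τ.torsionSubobject (fun i => T.free.obj (G i)) M)
      (τ.torsionSubobject (fun i => T.free.obj (G i)) M)

end EilenbergMoore

/-! ### Torsion classes, Gabriel filters and the torsion subobject, tested against torsion-free
objects. -/

section TorsionTheories

variable {A : Type u} [Category.{v} A] [Abelian A]

namespace TorsionTheory

variable (τ : TorsionTheory A)

/-! Each of the four statements holds outright for a hereditary `τ`. By the Leibniz rule, if `u ≫ D
j ≫ q` vanishes for all `j < i`, with `u`, `q` linear, then `u ≫ D i ≫ q` is `T`-linear
(`exists_hom_of_forall_lt`), so torsion arguments apply to it. For (ii), take `u` from a torsion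
module and `q` to a torsion-free one: by induction every composite is zero. For (i), view `Δ` as a
higher derivation on the free module and, one index at a time, replace `J` by the kernel of the
linear map `J ⟶ TG_i / I`; heredity keeps this kernel in the filter. Then (iii) and (iv) are (i)
applied to `ker g`. -/

theorem torsion_of_forall_hom_eq_zero {X : A}
    (h : ∀ Y, τ.torsionFree Y → ∀ f : X ⟶ Y, f = 0) : τ.torsion X := by
  obtain ⟨X', X'', f, g, w, hX', hX'', hS⟩ := τ.exists_shortExact X
  have := hS.mono_f
  have : Epi f := (hS.exact.epi_f_iff).2 (h _ hX'' g)
  have : IsIso f := isIso_of_mono_of_epi f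
  exact τ.torsion_of_iso (asIso f) hX'

theorem torsion_of_epi {X Y : A} (f : X ⟶ Y) [Epi f] (hX : τ.torsion X) : τ.torsion Y :=
  τ.torsion_of_forall_hom_eq_zero fun Z hZ g => by
    rw [← cancel_epi f, comp_zero]
    exact τ.hom_eq_zero hX hZ _

theorem mem_gabrielFilter_iff {X : A} (I : Subobject X) :
    I ∈ τ.gabrielFilter X ↔
      ∀ Y, τ.torsionFree Y → ∀ h : X ⟶ Y, I.arrow ≫ h = 0 → h = 0 := by
  constructor
  · intro hI Y hY h w
    rw [← cokernel.π_desc I.arrow h w, τ.hom_eq_zero hI hY (cokernel.desc I.arrow h w), comp_zero]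
  · intro h
    refine τ.torsion_of_forall_hom_eq_zero fun Y hY f => ?_
    rw [← cancel_epi (cokernel.π I.arrow), comp_zero]
    exact h Y hY _ (by simp)

variable {τ}

/-- A morphism to a torsion-free object vanishing on the kernel of a morphism to a torsion object
is zero. -/
theorem IsHereditary.eq_zero_of_kernel_comp_eq_zero (hτ : τ.IsHereditary) {X Q Y : A} (g : X ⟶ Q)
    (hQ : τ.torsion Q) (hY : τ.torsionFree Y) (h : X ⟶ Y) (w : kernel.ι g ≫ h = 0) : h = 0 := by
  have hc : τ.torsion (Abelian.coimage g) :=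
    hτ (Abelian.factorThruCoimage g) inferInstance hQ
  rw [← cokernel.π_desc (kernel.ι g) h w, τ.hom_eq_zero hc hY (cokernel.desc _ h w), comp_zero]

theorem IsHereditary.kernelSubobject_mem_gabrielFilter (hτ : τ.IsHereditary) {X Q : A} (g : X ⟶ Q)
    (hQ : τ.torsion Q) : kernelSubobject g ∈ τ.gabrielFilter X := by
  rw [mem_gabrielFilter_iff]
  intro Y hY h w
  refine hτ.eq_zero_of_kernel_comp_eq_zero g hQ hY h ?_
  rw [← kernelSubobject_arrow', Category.assoc, w, comp_zero]

/-- A map from `X` to a torsion-free object that kills `ker f` also kills `K`, since `K / ker f`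
embeds in `Q`; hence it is zero. -/
theorem IsHereditary.mk_kernel_comp_arrow_mem_gabrielFilter (hτ : τ.IsHereditary) {X Q : A}
    {K : Subobject X} (hK : K ∈ τ.gabrielFilter X) (f : (K : A) ⟶ Q) (hQ : τ.torsion Q) :
    Subobject.mk (kernel.ι f ≫ K.arrow) ∈ τ.gabrielFilter X := by
  rw [mem_gabrielFilter_iff] at hK ⊢
  intro Y hY h w
  refine hK Y hY h (hτ.eq_zero_of_kernel_comp_eq_zero f hQ hY _ ?_)
  rw [← Category.assoc, ← Subobject.underlyingIso_arrow (kernel.ι f ≫ K.arrow), Category.assoc,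
    w, comp_zero]

theorem torsion_of_mem_torsionSubobjects {Λ : Type w} {H : Λ → A}
    (hH : (ObjectProperty.ofObj H).IsSeparating) {M : A} {N : Subobject M}
    (hN : N ∈ τ.torsionSubobjects H M) : τ.torsion (N : A) := by
  refine τ.torsion_of_forall_hom_eq_zero fun Y hY f => hH _ _ ?_
  rintro _ ⟨i⟩ g
  rw [comp_zero]
  refine (τ.mem_gabrielFilter_iff _).1 (hN i g) Y hY _ ?_
  rw [← Category.assoc, kernelSubobject_arrow_comp, zero_comp]

/-- The kernel of a map from `M_τ` to a torsion-free object contains every summand of `M_τ`, hence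
all of `M_τ`. -/
theorem torsion_torsionSubobject [IsGrothendieckAbelian.{w} A] {Λ : Type w} {H : Λ → A}
    (hH : (ObjectProperty.ofObj H).IsSeparating) (M : A) :
    τ.torsion (τ.torsionSubobject H M : A) := by
  refine τ.torsion_of_forall_hom_eq_zero fun Y hY f => ?_
  have hle : τ.torsionSubobject H M ≤
      Subobject.mk (kernel.ι f ≫ (τ.torsionSubobject H M).arrow) := by
    refine sSup_le fun N hN => ?_
    have hN' : N ≤ τ.torsionSubobject H M := le_sSup hN
    refine Subobject.le_mk_of_comm (kernel.lift f (Subobject.ofLE _ _ hN')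
      (τ.hom_eq_zero (torsion_of_mem_torsionSubobjects hH hN) hY _)) ?_
    rw [← Category.assoc, kernel.lift_ι, Subobject.ofLE_arrow]
  have hid : Subobject.ofLEMk _ _ hle ≫ kernel.ι f = 𝟙 _ := by
    rw [← cancel_mono (τ.torsionSubobject H M).arrow, Category.assoc, Subobject.ofLEMk_comp,
      Category.id_comp]
  rw [← Category.id_comp f, ← hid, Category.assoc, kernel.condition, comp_zero]

theorem IsHereditary.le_torsionSubobject [IsGrothendieckAbelian.{w} A] (hτ : τ.IsHereditary)
    {Λ : Type w} (H : Λ → A) {M : A} {N : Subobject M} (hN : τ.torsion (N : A)) :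
    N ≤ τ.torsionSubobject H M :=
  le_sSup fun _ g => hτ.kernelSubobject_mem_gabrielFilter g hN

end TorsionTheory

end TorsionTheories

/-! ### Higher derivations on modules and their interaction with torsion. -/

section Derivations

theorem isSeparating_free_algebra {C : Type u} [Category.{v} C] (T : Monad C) {Λ : Type w}
    {G : Λ → C} (hG : (ObjectProperty.ofObj G).IsSeparating) :
    (ObjectProperty.ofObj fun i => T.free.obj (G i)).IsSeparating := by
  intro X Y f g h
  apply T.forget.map_injective
  refine hG _ _ ?_
  rintro _ ⟨i⟩ k
  have := congrArg (T.adj.homEquiv _ _)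
    (h _ (ObjectProperty.ofObj_apply _ i) ((T.adj.homEquiv _ _).symm k))
  simpa [Adjunction.homEquiv_naturality_right] using this

variable {C : Type u} [Category.{v} C] [Abelian C] {T : Monad C}
  [PreservesFiniteLimits T.toFunctor] [PreservesFiniteColimits T.toFunctor]

/-- The forgetful functor preserves kernels, so morphisms of `C` that are not linear also lift. -/
theorem exists_lift_of_shortExact {S : ShortComplex T.Algebra} (hS : S.ShortExact) {Z : C}
    (x : Z ⟶ S.X₂.A) (hx : x ≫ S.g.f = 0) : ∃ y : Z ⟶ S.X₁.A, y ≫ S.f.f = x := by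
  have := hS.mono_f
  have hker := isLimitForkMapOfIsLimit' T.forget S.zero hS.fIsKernel
  exact ⟨hker.lift (KernelFork.ofι x hx), hker.fac _ WalkingParallelPair.zero⟩

theorem mapsSubmodule_of_comp_cokernel_eq_zero {M N : T.Algebra} (φ : M.A ⟶ N.A) (K : Subobject M)
    (L : Subobject N) (h : K.arrow.f ≫ φ ≫ (cokernel.π L.arrow).f = 0) : MapsSubmodule φ K L :=
  exists_lift_of_shortExact (S := ShortComplex.mk L.arrow (cokernel.π L.arrow) (by simp))
    { exact := ShortComplex.exact_cokernel _ } (K.arrow.f ≫ φ) (by simpa using h)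

variable {n : ℕ} {Δ : HigherDerivation T n}

/-- A higher derivation on `T` is a higher derivation on each free `T`-module. -/
def HigherDerivation.free (Δ : HigherDerivation T n) (X : C) :
    ModuleHigherDerivation Δ (T.free.obj X) where
  D j := (Δ.Δ j).app X
  zero := by rw [Δ.zero]; rfl
  comm i := by
    have := NatTrans.congr_app (Δ.comm i) X
    simp only [NatTrans.comp_app, NatTrans.app_sum, NatTrans.hcomp_app] at this
    exact this

namespace ModuleHigherDerivation

variable {M : T.Algebra} (D : ModuleHigherDerivation Δ M)

/-- The first composite `u ≫ Dᵢ ≫ q` which does not vanish is `T`-linear. -/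
theorem exists_hom_of_forall_lt {K Q : T.Algebra} (u : K ⟶ M) (q : M ⟶ Q) (i : Fin (n + 1))
    (h : ∀ j < i, u.f ≫ D.D j ≫ q.f = 0) : ∃ φ : K ⟶ Q, φ.f = u.f ≫ D.D i ≫ q.f := by
  refine ⟨⟨u.f ≫ D.D i ≫ q.f, ?_⟩, rfl⟩
  have hterm : ∀ k, T.map u.f ≫ ((Δ.Δ k).app M.A ≫ T.map (D.D (i - k))) ≫ M.a ≫ q.f =
      (Δ.Δ k).app K.A ≫ T.map (u.f ≫ D.D (i - k) ≫ q.f) ≫ Q.a := by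
    intro k
    simp [q.h]
  have hsum : K.a ≫ u.f ≫ D.D i ≫ q.f =
      ∑ k ∈ Finset.Iic i, (Δ.Δ k).app K.A ≫ T.map (u.f ≫ D.D (i - k) ≫ q.f) ≫ Q.a := by
    rw [← Monad.Algebra.Hom.h_assoc, ← Category.assoc M.a, D.comm]
    simp only [← hterm, Preadditive.sum_comp, Preadditive.comp_sum, Category.assoc]
  -- Only `k = 0` survives, where `Δ 0 = 𝟙`; the other terms involve `D (i - k)` with `i - k < i`.
  rw [hsum, Finset.sum_eq_single 0]
  · simp [Δ.zero]
  · intro k hk hk0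
    have hlt : i - k < i := by
      rw [Finset.mem_Iic] at hk
      have hk0' : 0 < k := Fin.pos_iff_ne_zero.2 hk0
      rw [Fin.lt_def, Fin.sub_val_of_le hk]
      rw [Fin.lt_def, Fin.val_zero] at hk0'
      rw [Fin.le_def] at hk
      omega
    rw [h _ hlt, Functor.map_zero, zero_comp, comp_zero]
  · simp

theorem exists_mem_gabrielFilter_mapsSubmodule {τ : TorsionTheory T.Algebra} (hτ : τ.IsHereditary)
    {I : Subobject M} (hI : I ∈ τ.gabrielFilter M) :
    ∃ J ∈ τ.gabrielFilter M, ∀ j, MapsSubmodule (D.D j) J I := by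
  -- The bound `m` is a natural number, so the induction starts vacuously at `J = ⊤`.
  have key : ∀ m : ℕ, ∃ J ∈ τ.gabrielFilter M, ∀ j : Fin (n + 1), j.val < m →
      J.arrow.f ≫ D.D j ≫ (cokernel.π I.arrow).f = 0 := by
    intro m
    induction m with
    | zero =>
      refine ⟨⊤, (τ.mem_gabrielFilter_iff _).2 fun Y _ h w => ?_, fun j hj => by omega⟩
      rwa [← cancel_epi (⊤ : Subobject M).arrow, comp_zero]
    | succ m ih =>
      obtain ⟨J, hJ, hJm⟩ := ih
      by_cases hm : m < n + 1
      · obtain ⟨φ, hφ⟩ := D.exists_hom_of_forall_lt J.arrow (cokernel.π I.arrow) ⟨m, hm⟩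
          fun j hj => hJm j hj
        refine ⟨_, hτ.mk_kernel_comp_arrow_mem_gabrielFilter hJ φ hI, fun j hj => ?_⟩
        have hzero : (kernel.ι φ).f ≫ J.arrow.f ≫ D.D j ≫ (cokernel.π I.arrow).f = 0 := by
          rcases Nat.lt_succ_iff_lt_or_eq.1 hj with hlt | rfl
          · rw [hJm j hlt, comp_zero]
          · rw [← hφ]
            exact congrArg Monad.Algebra.Hom.f (kernel.condition φ)
        rw [← Subobject.underlyingIso_hom_comp_eq_mk, Monad.Algebra.comp_f, Monad.Algebra.comp_f,
          Category.assoc, Category.assoc, hzero, comp_zero]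
      · exact ⟨J, hJ, fun j hj => hJm j (by omega)⟩
  obtain ⟨J, hJ, h⟩ := key (n + 1)
  exact ⟨J, hJ, fun j => mapsSubmodule_of_comp_cokernel_eq_zero _ _ _ (h j j.isLt)⟩

theorem comp_comp_eq_zero_of_torsion {τ : TorsionTheory T.Algebra} {K Q : T.Algebra}
    (hK : τ.torsion K) (hQ : τ.torsionFree Q) (u : K ⟶ M) (q : M ⟶ Q) (i : Fin (n + 1)) :
    u.f ≫ D.D i ≫ q.f = 0 := by
  induction i using WellFoundedLT.induction with
  | ind i ih =>
    obtain ⟨φ, hφ⟩ := D.exists_hom_of_forall_lt u q i ih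
    rw [← hφ, τ.hom_eq_zero hK hQ φ]
    rfl

end ModuleHigherDerivation

/-- The Gabriel filters of a hereditary torsion theory are invariant under higher derivations. -/
theorem isDeltaInvariant_of_isHereditary (Δ : HigherDerivation T n) {τ : TorsionTheory T.Algebra}
    (hτ : τ.IsHereditary) {Λ : Type w} (G : Λ → C) : IsDeltaInvariant Δ τ G :=
  fun i _ hI => (Δ.free (G i)).exists_mem_gabrielFilter_mapsSubmodule hτ hI

/-- Hereditary torsion theories are higher differential. -/
theorem isHigherDifferential_of_isHereditary [IsGrothendieckAbelian.{w} C]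
    [PreservesColimitsOfSize.{w, w} T.toFunctor] (Δ : HigherDerivation T n)
    {τ : TorsionTheory T.Algebra} (hτ : τ.IsHereditary) {Λ : Type w} {G : Λ → C}
    (hG : (ObjectProperty.ofObj G).IsSeparating) : IsHigherDifferential Δ τ G := by
  intro M D j
  -- `D j` carries `M_τ` into the torsion part `M'`, which lies in `M_τ` by heredity.
  obtain ⟨M', M'', f, g, w, hM', hM'', hS⟩ := τ.exists_shortExact M
  have : Mono f := hS.mono_f
  have hle : Subobject.mk f ≤ τ.torsionSubobject (fun i => T.free.obj (G i)) M :=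
    hτ.le_torsionSubobject _ (τ.torsion_of_iso (Subobject.underlyingIso f).symm hM')
  obtain ⟨y, hy⟩ := exists_lift_of_shortExact hS
    ((τ.torsionSubobject (fun i => T.free.obj (G i)) M).arrow.f ≫ D.D j) (by
      rw [Category.assoc]
      exact D.comp_comp_eq_zero_of_torsion
        (TorsionTheory.torsion_torsionSubobject (isSeparating_free_algebra T hG) M) hM'' _ _ j)
  refine ⟨y ≫ (Subobject.ofMkLE f _ hle).f, ?_⟩
  rw [Category.assoc, ← hy, ← Monad.Algebra.comp_f, Subobject.ofMkLE_arrow]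

end Derivations

theorem mainTheorem3 {C : Type u} [Category.{v} C] [Abelian C] [IsGrothendieckAbelian.{w} C]
    {Λ : Type w} (G : Λ → C)
    (hfg : ∀ i, IsFinitelyGeneratedObject (G i)) (hproj : ∀ i, Projective (G i))
    (hgen : (ObjectProperty.ofObj G).IsSeparating)
    (T : Monad C) [PreservesFiniteLimits T.toFunctor] [PreservesFiniteColimits T.toFunctor]
    [PreservesColimitsOfSize.{w, w} T.toFunctor]
    {n : ℕ} (Δ : HigherDerivation T n)
    (τ : TorsionTheory T.Algebra) (hτ : τ.IsHereditary) :
    List.TFAE [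
      IsDeltaInvariant Δ τ G,
      IsHigherDifferential Δ τ G,
      ∀ (M : T.Algebra) (_ : ModuleHigherDerivation Δ M) (N : Subobject M),
        N ≤ τ.torsionSubobject (fun i => T.free.obj (G i)) M →
        ∀ (j : Fin (n + 1)) (i : Λ) (g : T.free.obj (G i) ⟶ (N : T.Algebra)),
          ∃ K ∈ τ.gabrielFilter (T.free.obj (G i)),
            MapsSubmodule ((Δ.Δ j).app (G i)) K (kernelSubobject g),
      ∀ (M : T.Algebra) (_ : ModuleHigherDerivation Δ M) (N : Subobject M),
        N ≤ τ.torsionSubobject (fun i => T.free.obj (G i)) M →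
        ∀ (i : Λ) (g : T.free.obj (G i) ⟶ (N : T.Algebra)),
          ∃ K ∈ τ.gabrielFilter (T.free.obj (G i)),
            ∀ j : Fin (n + 1), MapsSubmodule ((Δ.Δ j).app (G i)) K (kernelSubobject g)
    ] := by
  have hT := isSeparating_free_algebra T hgen
  have h₁ : IsDeltaInvariant Δ τ G := isDeltaInvariant_of_isHereditary Δ hτ G
  have h₄ : ∀ (M : T.Algebra) (N : Subobject M),
      N ≤ τ.torsionSubobject (fun i => T.free.obj (G i)) M →
      ∀ (i : Λ) (g : T.free.obj (G i) ⟶ (N : T.Algebra)),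
        ∃ K ∈ τ.gabrielFilter (T.free.obj (G i)),
          ∀ j : Fin (n + 1), MapsSubmodule ((Δ.Δ j).app (G i)) K (kernelSubobject g) := by
    intro M N hN i g
    exact h₁ i _ (hτ.kernelSubobject_mem_gabrielFilter g
      (hτ (Subobject.ofLE _ _ hN) inferInstance (TorsionTheory.torsion_torsionSubobject hT M)))
  apply List.tfae_of_forall True
  simp only [List.mem_cons, List.not_mem_nil, or_false, iff_true, forall_eq_or_imp, forall_eq]
  refine ⟨h₁, isHigherDifferential_of_isHereditary Δ hτ hgen, fun M _ N hN j i g => ?_,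
    fun M _ N hN i g => h₄ M N hN i g⟩
  obtain ⟨K, hK, h⟩ := h₄ M N hN i g
  exact ⟨K, hK, h j⟩
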